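/- Let $K$ be a commutative ring with unit, let $A$ and $B$ be associative unital $K$-algebras, and let $M$ be an $(A,B)$-bimodule that is $K$-symmetric ($km=mk$ for all $k\in K$, $m\in M$), with $M_B$ finitely generated and projective as a right $B$-module. Write $\mathcal E_M=\mathrm{Mod}_B(M,M)$ for the endomorphism ring of $M_B$ (with composition as multiplication), $i_M:A\to\mathcal E_M$, $a\mapsto[m\mapsto am]$, for the corresponding ring homomorphism, through which $\mathcal E_M$ is an $(A,A)$-bimodule, and $M^*=\mathrm{Mod}_B(M,B)$ for the dual, a $(B,A)$-bimodule via $(bfa)(m)=b\,f(am)$. For an $(A,A)$-bimodule $X$ let $X^+=\mathbf{Ab}(X,\mathbb Q/\mathbb Z)$ be its character bimodule, with $(afa')(x)=f(a'xa)$, and let $(i_M)^+:(\mathcal E_M)^+\to A^+$ be $\varphi\mapsto\varphi\circ i_M$. Suppose that $A$ is $K$-separable, that is, projective as a module over $A\otimes_K A^{\mathrm{op}}$. Then the following are equivalent: (i) ${}_AM_B$ is totally faithful as a left $A$-module: for every right $A$-module $X$ the map $X\to \mathrm{Mod}_B(M,X\otimes_A M)$, $x\mapsto[m\mapsto x\otimes_A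 m]$, is injective; (ii) ${}_BM^*_A$ is totally faithful as a right $A$-module: for every left $A$-module $Y$ the map $Y\to {}_B\mathrm{Mod}(M^*,M^*\otimes_A Y)$, $y\mapsto[f\mapsto f\otimes_A y]$, is injective; (iii) $(i_M)^+:(\mathcal E_M)^+\to A^+$ is a split epimorphism of $(A,A)$-bimodules; (iv) the functor $-\otimes_A M:\mathrm{Mod}_A\to\mathrm{Mod}_B$ is comonadic; (v) the functor $M^*\otimes_A-:{}_A\mathrm{Mod}\to{}_B\mathrm{Mod}$ is comonadic. -/

import Mathlib

open CategoryTheory MulOpposite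
open scoped TensorProduct

universe u v

/-! A right module over a ring `A` is a module over the opposite ring `Aᵐᵒᵖ`, with
`op a • x` standing for `x · a`.  An `(A, B)`-bimodule is an abelian group with `Module A`,
`Module Bᵐᵒᵖ` and `SMulCommClass A Bᵐᵒᵖ`. -/

/-! ### The tensor product over a noncommutative ring -/

/-- The subgroup of `X ⊗[ℤ] M` generated by the elements `(x · a) ⊗ m - x ⊗ (a · m)`. -/
def balancedRelations (A : Type*) [Ring A] (X M : Type*) [AddCommGroup X] [AddCommGroup M]
    [Module Aᵐᵒᵖ X] [Module A M] : Submodule ℤ (X ⊗[ℤ] M) :=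
  Submodule.span ℤ
    {t | ∃ (x : X) (a : A) (m : M), t = (op a • x) ⊗ₜ[ℤ] m - x ⊗ₜ[ℤ] (a • m)}

/-- The tensor product `X ⊗_A M` of a right `A`-module `X` and a left `A`-module `M`. -/
def BalancedTensor (A : Type*) [Ring A] (X M : Type*) [AddCommGroup X] [AddCommGroup M]
    [Module Aᵐᵒᵖ X] [Module A M] : Type _ :=
  (X ⊗[ℤ] M) ⧸ balancedRelations A X M

namespace BalancedTensor

section Basic

variable (A : Type*) [Ring A] {X X' X'' M M' M'' : Type*}
  [AddCommGroup X] [AddCommGroup X'] [AddCommGroup X'']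
  [AddCommGroup M] [AddCommGroup M'] [AddCommGroup M'']
  [Module Aᵐᵒᵖ X] [Module Aᵐᵒᵖ X'] [Module Aᵐᵒᵖ X'']
  [Module A M] [Module A M'] [Module A M'']

instance : AddCommGroup (BalancedTensor A X M) :=
  inferInstanceAs (AddCommGroup ((X ⊗[ℤ] M) ⧸ balancedRelations A X M))

/-- The pure tensor `x ⊗_A m`. -/
def tmul (x : X) (m : M) : BalancedTensor A X M :=
  Submodule.Quotient.mk (p := balancedRelations A X M) (x ⊗ₜ[ℤ] m)

theorem add_tmul (x y : X) (m : M) : tmul A (x + y) m = tmul A x m + tmul A y m := by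
  unfold tmul
  rw [TensorProduct.add_tmul]
  rfl

theorem tmul_add (x : X) (m n : M) : tmul A x (m + n) = tmul A x m + tmul A x n := by
  unfold tmul
  rw [TensorProduct.tmul_add]
  rfl

theorem zero_tmul (m : M) : tmul A (0 : X) m = 0 := by
  simpa using add_tmul A (0 : X) 0 m

theorem tmul_zero (x : X) : tmul A x (0 : M) = 0 := by
  simpa using tmul_add A x (0 : M) 0

theorem op_smul_tmul (x : X) (a : A) (m : M) : tmul A (op a • x) m = tmul A x (a • m) :=
  (Submodule.Quotient.eq _).2 (Submodule.subset_span ⟨x, a, m, rfl⟩)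

@[elab_as_elim]
theorem induction_on {p : BalancedTensor A X M → Prop} (t : BalancedTensor A X M)
    (zero : p 0) (tmul : ∀ x m, p (tmul A x m)) (add : ∀ s t, p s → p t → p (s + t)) : p t := by
  obtain ⟨t, rfl⟩ := Submodule.Quotient.mk_surjective (balancedRelations A X M) t
  induction t using TensorProduct.induction_on with
  | zero => exact zero
  | tmul x m => exact tmul x m
  | add s t hs ht => exact add _ _ hs ht

/-- Two additive maps out of `X ⊗_A M` that agree on pure tensors are equal. -/
theorem hom_ext {P : Type*} [AddCommGroup P] {f g : BalancedTensor A X M →+ P}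
    (h : ∀ x m, f (tmul A x m) = g (tmul A x m)) : f = g := by
  ext t
  induction t using induction_on with
  | zero => simp
  | tmul x m => exact h x m
  | add s t hs ht => simp [hs, ht]

/-- The additive map out of `X ⊗_A M` given by an `A`-balanced biadditive map. -/
def lift {P : Type*} [AddCommGroup P] (f : X →+ M →+ P)
    (hf : ∀ x (a : A) m, f (op a • x) m = f x (a • m)) : BalancedTensor A X M →+ P :=
  (Submodule.liftQ (balancedRelations A X M)
    (TensorProduct.liftAddHom f (fun r x m => by simp)).toIntLinearMap (by
      refine Submodule.span_le.2 ?_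
      rintro _ ⟨x, a, m, rfl⟩
      simp [hf])).toAddMonoidHom

@[simp]
theorem lift_tmul {P : Type*} [AddCommGroup P] (f : X →+ M →+ P)
    (hf : ∀ x (a : A) m, f (op a • x) m = f x (a • m)) (x : X) (m : M) :
    lift A f hf (tmul A x m) = f x m := rfl

/-- `f ⊗_A g`. -/
def map (f : X →ₗ[Aᵐᵒᵖ] X') (g : M →ₗ[A] M') : BalancedTensor A X M →+ BalancedTensor A X' M' :=
  lift A
    (AddMonoidHom.mk' (fun x => AddMonoidHom.mk' (fun m => tmul A (f x) (g m))
        (fun m n => by rw [map_add, tmul_add]))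
      (fun x y => by ext m; simp [add_tmul]))
    (fun x a m => by simp [op_smul_tmul])

@[simp]
theorem map_tmul (f : X →ₗ[Aᵐᵒᵖ] X') (g : M →ₗ[A] M') (x : X) (m : M) :
    map A f g (tmul A x m) = tmul A (f x) (g m) := rfl

theorem map_id : map A (LinearMap.id : X →ₗ[Aᵐᵒᵖ] X) (LinearMap.id : M →ₗ[A] M) =
    AddMonoidHom.id _ :=
  hom_ext A fun _ _ => rfl

theorem map_comp (f' : X' →ₗ[Aᵐᵒᵖ] X'') (f : X →ₗ[Aᵐᵒᵖ] X') (g' : M' →ₗ[A] M'')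
    (g : M →ₗ[A] M') :
    map A (f' ∘ₗ f) (g' ∘ₗ g) = (map A f' g').comp (map A f g) :=
  hom_ext A fun _ _ => rfl

end Basic

section Right

variable (A B : Type*) [Ring A] [Ring B] (X : Type*) [AddCommGroup X] [Module Aᵐᵒᵖ X]
  (M : Type*) [AddCommGroup M] [Module A M] [Module Bᵐᵒᵖ M] [SMulCommClass A Bᵐᵒᵖ M]

/-- For an `(A, B)`-bimodule `M`, the right `B`-module structure on `X ⊗_A M`,
`(x ⊗ m) · b = x ⊗ (m · b)`. -/
@[reducible]
def rightModule : Module Bᵐᵒᵖ (BalancedTensor A X M) :=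
  haveI := SMulCommClass.symm A Bᵐᵒᵖ M
  Module.compHom (BalancedTensor A X M)
    ({ toFun := fun b => map A LinearMap.id (Module.toModuleEnd A M b)
       map_one' := hom_ext A fun x m => congrArg (tmul A x) (one_smul Bᵐᵒᵖ m)
       map_mul' := fun b c => hom_ext A fun x m => congrArg (tmul A x) (mul_smul b c m)
       map_zero' := hom_ext A fun x m => (congrArg (tmul A x) (zero_smul Bᵐᵒᵖ m)).trans
        (tmul_zero A x)
       map_add' := fun b c => hom_ext A fun x m => (congrArg (tmul A x) (add_smul b c m)).trans
        (tmul_add A x _ _) } :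
      Bᵐᵒᵖ →+* AddMonoid.End (BalancedTensor A X M))

theorem rightModule_smul_tmul (b : Bᵐᵒᵖ) (x : X) (m : M) :
    letI := rightModule A B X M
    b • tmul A x m = tmul A x (b • m) := rfl

end Right

section Left

variable (A B : Type*) [Ring A] [Ring B] (N : Type*) [AddCommGroup N] [Module B N]
  [Module Aᵐᵒᵖ N] [SMulCommClass B Aᵐᵒᵖ N] (Y : Type*) [AddCommGroup Y] [Module A Y]

/-- For a `(B, A)`-bimodule `N`, the left `B`-module structure on `N ⊗_A Y`,
`b · (n ⊗ y) = (b · n) ⊗ y`. -/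
@[reducible]
def leftModule : Module B (BalancedTensor A N Y) :=
  Module.compHom (BalancedTensor A N Y)
    ({ toFun := fun b => map A (Module.toModuleEnd Aᵐᵒᵖ N b) LinearMap.id
       map_one' := hom_ext A fun n y => congrArg (tmul A · y) (one_smul B n)
       map_mul' := fun b c => hom_ext A fun n y => congrArg (tmul A · y) (mul_smul b c n)
       map_zero' := hom_ext A fun n y => (congrArg (tmul A · y) (zero_smul B n)).trans
        (zero_tmul A y)
       map_add' := fun b c => hom_ext A fun n y => (congrArg (tmul A · y) (add_smul b c n)).trans
        (add_tmul A _ _ y) } :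
      B →+* AddMonoid.End (BalancedTensor A N Y))

theorem leftModule_smul_tmul (b : B) (n : N) (y : Y) :
    letI := leftModule A B N Y
    b • tmul A n y = tmul A (b • n) y := rfl

end Left

end BalancedTensor

/-! ### The tensor functors -/

section Functors

variable (A B : Type u) [Ring A] [Ring B]

/-- For an `(A, B)`-bimodule `M`, the functor `- ⊗_A M` from right `A`-modules to right
`B`-modules. -/
def tensorRightFunctor (M : Type u) [AddCommGroup M] [Module A M] [Module Bᵐᵒᵖ M]
    [SMulCommClass A Bᵐᵒᵖ M] : ModuleCat.{u} Aᵐᵒᵖ ⥤ ModuleCat.{u} Bᵐᵒᵖ where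
  obj X :=
    letI := BalancedTensor.rightModule A B X M
    ModuleCat.of Bᵐᵒᵖ (BalancedTensor A X M)
  map {X X'} f :=
    letI := BalancedTensor.rightModule A B X M
    letI := BalancedTensor.rightModule A B X' M
    ModuleCat.ofHom
      { BalancedTensor.map A f.hom (LinearMap.id : M →ₗ[A] M) with
        map_smul' := fun b t => by
          induction t using BalancedTensor.induction_on with
          | zero => simp
          | tmul x m => rfl
          | add s t hs ht => simp_all }
  map_id X :=
    letI := BalancedTensor.rightModule A B X M
    ModuleCat.hom_ext <| LinearMap.ext fun t =>
    DFunLike.congr_fun (BalancedTensor.map_id A (X := X) (M := M)) t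
  map_comp {X _ Z} f g :=
    letI := BalancedTensor.rightModule A B X M
    letI := BalancedTensor.rightModule A B Z M
    ModuleCat.hom_ext <| LinearMap.ext fun t =>
    DFunLike.congr_fun (BalancedTensor.map_comp A g.hom f.hom
      (LinearMap.id : M →ₗ[A] M) LinearMap.id) t

/-- For a `(B, A)`-bimodule `N`, the functor `N ⊗_A -` from left `A`-modules to left
`B`-modules. -/
def tensorLeftFunctor (N : Type u) [AddCommGroup N] [Module B N] [Module Aᵐᵒᵖ N]
    [SMulCommClass B Aᵐᵒᵖ N] : ModuleCat.{u} A ⥤ ModuleCat.{u} B where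
  obj Y :=
    letI := BalancedTensor.leftModule A B N Y
    ModuleCat.of B (BalancedTensor A N Y)
  map {Y Y'} f :=
    letI := BalancedTensor.leftModule A B N Y
    letI := BalancedTensor.leftModule A B N Y'
    ModuleCat.ofHom
      { BalancedTensor.map A (LinearMap.id : N →ₗ[Aᵐᵒᵖ] N) f.hom with
        map_smul' := fun b t => by
          induction t using BalancedTensor.induction_on with
          | zero => simp
          | tmul n y => rfl
          | add s t hs ht => simp_all }
  map_id Y :=
    letI := BalancedTensor.leftModule A B N Y
    ModuleCat.hom_ext <| LinearMap.ext fun t =>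
    DFunLike.congr_fun (BalancedTensor.map_id A (X := N) (M := Y)) t
  map_comp {X _ Z} f g :=
    letI := BalancedTensor.leftModule A B N X
    letI := BalancedTensor.leftModule A B N Z
    ModuleCat.hom_ext <| LinearMap.ext fun t =>
    DFunLike.congr_fun (BalancedTensor.map_comp A
      (LinearMap.id : N →ₗ[Aᵐᵒᵖ] N) LinearMap.id g.hom f.hom) t

/-- A functor is comonadic if it has a right adjoint for which the comparison functor to the
category of coalgebras of the induced comonad is an equivalence. -/
def IsComonadic {C D : Type*} [Category C] [Category D] (F : C ⥤ D) : Prop :=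
  Nonempty (ComonadicLeftAdjoint F)

end Functors

/-! ### Totally faithful bimodules -/

section TotallyFaithful

variable (A B : Type u) [Ring A] [Ring B]

/-- The map `X → Mod_B(M, X ⊗_A M)`, `x ↦ (m ↦ x ⊗ m)`. -/
def tensorUnit (M : Type u) [AddCommGroup M] [Module A M] [Module Bᵐᵒᵖ M]
    [SMulCommClass A Bᵐᵒᵖ M] (X : Type u) [AddCommGroup X] [Module Aᵐᵒᵖ X] :
    letI := BalancedTensor.rightModule A B X M
    X → (M →ₗ[Bᵐᵒᵖ] BalancedTensor A X M) :=
  letI := BalancedTensor.rightModule A B X M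
  fun x =>
    { toFun := fun m => BalancedTensor.tmul A x m
      map_add' := BalancedTensor.tmul_add A x
      map_smul' := fun _ _ => rfl }

/-- The map `Y → _BMod(N, N ⊗_A Y)`, `y ↦ (n ↦ n ⊗ y)`. -/
def tensorUnitLeft (N : Type u) [AddCommGroup N] [Module B N] [Module Aᵐᵒᵖ N]
    [SMulCommClass B Aᵐᵒᵖ N] (Y : Type u) [AddCommGroup Y] [Module A Y] :
    letI := BalancedTensor.leftModule A B N Y
    Y → (N →ₗ[B] BalancedTensor A N Y) :=
  letI := BalancedTensor.leftModule A B N Y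
  fun y =>
    { toFun := fun n => BalancedTensor.tmul A n y
      map_add' := fun n n' => BalancedTensor.add_tmul A n n' y
      map_smul' := fun _ _ => rfl }

/-- The `(A, B)`-bimodule `M` is totally faithful as a left `A`-module. -/
def TotallyFaithfulLeft (M : Type u) [AddCommGroup M] [Module A M] [Module Bᵐᵒᵖ M]
    [SMulCommClass A Bᵐᵒᵖ M] : Prop :=
  ∀ (X : Type u) [AddCommGroup X] [Module Aᵐᵒᵖ X], Function.Injective (tensorUnit A B M X)

/-- The `(B, A)`-bimodule `N` is totally faithful as a right `A`-module. -/
def TotallyFaithfulRight (N : Type u) [AddCommGroup N] [Module B N] [Module Aᵐᵒᵖ N]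
    [SMulCommClass B Aᵐᵒᵖ N] : Prop :=
  ∀ (Y : Type u) [AddCommGroup Y] [Module A Y], Function.Injective (tensorUnitLeft A B N Y)

end TotallyFaithful

/-! ### The dual of a bimodule -/

/-- The dual `M^* = Mod_B(M, B)` of a right `B`-module `M`. -/
def RightDual (B M : Type*) [Ring B] [AddCommGroup M] [Module Bᵐᵒᵖ M] : Type _ :=
  M →ₗ[Bᵐᵒᵖ] B

namespace RightDual

variable (A B M : Type*) [Ring A] [Ring B] [AddCommGroup M] [Module Bᵐᵒᵖ M]

instance : AddCommGroup (RightDual B M) := inferInstanceAs (AddCommGroup (M →ₗ[Bᵐᵒᵖ] B))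

/-- `(b · f)(m) = b f(m)`. -/
instance : Module B (RightDual B M) := inferInstanceAs (Module B (M →ₗ[Bᵐᵒᵖ] B))

variable [Module A M] [SMulCommClass A Bᵐᵒᵖ M]

/-- `(f · a)(m) = f(a m)`. -/
instance : Module Aᵐᵒᵖ (RightDual B M) where
  smul a f := LinearMap.comp (show M →ₗ[Bᵐᵒᵖ] B from f) (Module.toModuleEnd Bᵐᵒᵖ M a.unop)
  one_smul f := LinearMap.ext fun m => congrArg (show M →ₗ[Bᵐᵒᵖ] B from f) (one_smul A m)
  mul_smul a b f := LinearMap.ext fun m =>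
    congrArg (show M →ₗ[Bᵐᵒᵖ] B from f) (mul_smul b.unop a.unop m)
  smul_zero _ := rfl
  smul_add _ _ _ := rfl
  zero_smul f := LinearMap.ext fun m =>
    (congrArg (show M →ₗ[Bᵐᵒᵖ] B from f) (zero_smul A m)).trans
      (map_zero (show M →ₗ[Bᵐᵒᵖ] B from f))
  add_smul a b f := LinearMap.ext fun m =>
    (congrArg (show M →ₗ[Bᵐᵒᵖ] B from f) (add_smul a.unop b.unop m)).trans
      (map_add (show M →ₗ[Bᵐᵒᵖ] B from f) _ _)

instance : SMulCommClass B Aᵐᵒᵖ (RightDual B M) where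
  smul_comm _ _ _ := rfl

end RightDual

/-! ### Morphisms of bimodules and character bimodules -/

/-- A morphism of `(A, B)`-bimodules: an additive map that is left `A`-linear and right
`B`-linear. -/
structure BimoduleHom (A B : Type*) [Ring A] [Ring B] (M N : Type*) [AddCommGroup M]
    [AddCommGroup N] [Module A M] [Module Bᵐᵒᵖ M] [Module A N] [Module Bᵐᵒᵖ N]
    extends M →+ N where
  map_smul' : ∀ (a : A) (m : M), toFun (a • m) = a • toFun m
  map_op_smul' : ∀ (b : B) (m : M), toFun (op b • m) = op b • toFun m

/-- A morphism of bimodules is a split epimorphism if it has a right inverse that is a morphism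
of bimodules. -/
def BimoduleHom.IsSplitEpi {A B M N : Type*} [Ring A] [Ring B] [AddCommGroup M]
    [AddCommGroup N] [Module A M] [Module Bᵐᵒᵖ M] [Module A N] [Module Bᵐᵒᵖ N]
    (f : BimoduleHom A B M N) : Prop :=
  ∃ s : BimoduleHom A B N M, ∀ n : N, f.toFun (s.toFun n) = n

/-- The character bimodule `X^+ = Ab(X, ℚ/ℤ)`. -/
def CharacterBimodule (X : Type*) [AddCommGroup X] : Type _ := X →+ AddCircle (1 : ℚ)

namespace CharacterBimodule

variable {A B : Type*} [Ring A] [Ring B] {X X' : Type*} [AddCommGroup X] [AddCommGroup X']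

instance : AddCommGroup (CharacterBimodule X) :=
  inferInstanceAs (AddCommGroup (X →+ AddCircle (1 : ℚ)))

/-- `(b · f)(x) = f(x · b)`. -/
instance [Module Bᵐᵒᵖ X] : Module B (CharacterBimodule X) where
  smul b f := AddMonoidHom.comp (show X →+ AddCircle (1 : ℚ) from f)
    (DistribSMul.toAddMonoidHom X (op b))
  one_smul f := AddMonoidHom.ext fun x =>
    congrArg (show X →+ AddCircle (1 : ℚ) from f) (one_smul Bᵐᵒᵖ x)
  mul_smul b c f := AddMonoidHom.ext fun x =>
    congrArg (show X →+ AddCircle (1 : ℚ) from f) (mul_smul (op c) (op b) x)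
  smul_zero _ := rfl
  smul_add _ _ _ := rfl
  zero_smul f := AddMonoidHom.ext fun x =>
    (congrArg (show X →+ AddCircle (1 : ℚ) from f) (zero_smul Bᵐᵒᵖ x)).trans
      (map_zero (show X →+ AddCircle (1 : ℚ) from f))
  add_smul b c f := AddMonoidHom.ext fun x =>
    (congrArg (show X →+ AddCircle (1 : ℚ) from f) (add_smul (op b) (op c) x)).trans
      (map_add (show X →+ AddCircle (1 : ℚ) from f) _ _)

/-- `(f · a)(x) = f(a · x)`. -/
instance [Module A X] : Module Aᵐᵒᵖ (CharacterBimodule X) where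
  smul a f := AddMonoidHom.comp (show X →+ AddCircle (1 : ℚ) from f)
    (DistribSMul.toAddMonoidHom X a.unop)
  one_smul f := AddMonoidHom.ext fun x =>
    congrArg (show X →+ AddCircle (1 : ℚ) from f) (one_smul A x)
  mul_smul a b f := AddMonoidHom.ext fun x =>
    congrArg (show X →+ AddCircle (1 : ℚ) from f) (mul_smul b.unop a.unop x)
  smul_zero _ := rfl
  smul_add _ _ _ := rfl
  zero_smul f := AddMonoidHom.ext fun x =>
    (congrArg (show X →+ AddCircle (1 : ℚ) from f) (zero_smul A x)).trans
      (map_zero (show X →+ AddCircle (1 : ℚ) from f))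
  add_smul a b f := AddMonoidHom.ext fun x =>
    (congrArg (show X →+ AddCircle (1 : ℚ) from f) (add_smul a.unop b.unop x)).trans
      (map_add (show X →+ AddCircle (1 : ℚ) from f) _ _)

/-- The morphism `g^+ : X'^+ → X^+`, `φ ↦ φ ∘ g`, of `(B, A)`-bimodules induced by a morphism
`g : X → X'` of `(A, B)`-bimodules. -/
def map [Module A X] [Module Bᵐᵒᵖ X] [Module A X'] [Module Bᵐᵒᵖ X'] (g : BimoduleHom A B X X') :
    BimoduleHom B A (CharacterBimodule X') (CharacterBimodule X) where
  toFun φ := AddMonoidHom.comp (show X' →+ AddCircle (1 : ℚ) from φ) g.toAddMonoidHom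
  map_zero' := rfl
  map_add' _ _ := rfl
  map_smul' b φ := AddMonoidHom.ext fun x =>
    (congrArg (show X' →+ AddCircle (1 : ℚ) from φ) (g.map_op_smul' b x)).symm
  map_op_smul' a φ := AddMonoidHom.ext fun x =>
    (congrArg (show X' →+ AddCircle (1 : ℚ) from φ) (g.map_smul' a x)).symm

end CharacterBimodule

/-! ### The bimodule of a ring homomorphism, and `i_M` -/

/-- The ring `R`, viewed as an `(A, A)`-bimodule through a ring homomorphism `i : A → R`. -/
def AlongHom {A R : Type*} [Ring A] [Ring R] (_i : A →+* R) : Type _ := R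

namespace AlongHom

variable {A R : Type*} [Ring A] [Ring R] (i : A →+* R)

instance : AddCommGroup (AlongHom i) := inferInstanceAs (AddCommGroup R)

/-- `a · r = i(a) r`. -/
instance : Module A (AlongHom i) := Module.compHom R i

/-- `r · a = r i(a)`. -/
instance : Module Aᵐᵒᵖ (AlongHom i) := Module.compHom R i.op

/-- A ring homomorphism `i : A → R`, as a morphism of `(A, A)`-bimodules. -/
def hom : BimoduleHom A A A (AlongHom i) where
  toFun := i
  map_zero' := map_zero i
  map_add' := map_add i
  map_smul' a b := map_mul i a b
  map_op_smul' a b := map_mul i b a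

end AlongHom

/-- The ring homomorphism `i_M : A → Mod_B(M, M)`, `a ↦ (m ↦ a m)`. -/
def leftMulHom (A B M : Type*) [Ring A] [Ring B] [AddCommGroup M] [Module A M] [Module Bᵐᵒᵖ M]
    [SMulCommClass A Bᵐᵒᵖ M] : A →+* Module.End Bᵐᵒᵖ M :=
  Module.toModuleEnd Bᵐᵒᵖ M

/-! ### Separable algebras -/

/-- A `K`-algebra `A` is separable if it is projective as a (`K`-symmetric) `(A, A)`-bimodule, that
is, as a module over `A ⊗[K] Aᵐᵒᵖ` with `(a ⊗ a') · x = a x a'`. -/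
def IsSeparableAlgebra (K A : Type*) [CommRing K] [Ring A] [Algebra K A] : Prop :=
  letI : Module (A ⊗[K] Aᵐᵒᵖ) A := TensorProduct.Algebra.module
  Module.Projective (A ⊗[K] Aᵐᵒᵖ) A

/-! ### Characters -/

/-! The implications close up as (i) → (iii) → (iv) → (i) and (ii) → (iii) → (v) → (ii). All of them
concern the unit `X → Hom(M, X ⊗ M)`, studied after passage to characters, where `ℚ/ℤ` is injective
and separates points. `TensorPresentation` covers both functors, so that each argument is made once.

(i), (ii) → (iii). If the unit at the character module of the ring is injective, evaluation at `1`
extends to a character `ψ` of the Hom group, and `φ ↦ (e ↦ ψ (unit φ ∘ e))` extends characters of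
the ring to endomorphisms, equivariantly on one side (`TensorPresentation.exists_extension`).
Starting from the dual of `M`, transposition brings this back to endomorphisms of `M`. Averaging
over a separability element makes the extension two-sided (`exists_splitting_of_right`,
`exists_splitting_of_left`); separability enters only here.

(iii) → (iv), (v). Evaluating a two-sided splitting on rank-one endomorphisms built from a dual
basis gives `SplittingForms`, and these give a section `splitChar`, natural in `X`, of the
restriction of characters along the unit. Hence the functor is faithful. For an `F`-cosplit pair,
`splitChar` lets characters of `F` of the equalizer extend to `F.obj X`, and shows that every
character killing the image of that equalizer kills the equalizer of the images; so `F` preserves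
the equalizer (`preservesLimit_of_isCosplitPair`), and Beck's theorem applies.

(iv) → (i), (v) → (ii). A comonadic functor is faithful. An element of `X` is a map from the free
module of rank one, and if the unit kills the element then tensoring kills the map. -/

/-- Additive characters with values in `ℚ/ℤ`. -/
abbrev AddCharacter (X : Type*) [AddCommGroup X] : Type _ := X →+ AddCircle (1 : ℚ)

theorem AddCharacter.exists_extension {X Y : Type*} [AddCommGroup X] [AddCommGroup Y]
    (f : X →+ Y) (hf : Function.Injective f) (χ : AddCharacter X) :
    ∃ ψ : AddCharacter Y, ∀ x, ψ (f x) = χ x := by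
  obtain ⟨ψ, hψ⟩ := CharacterModule.dual_surjective_of_injective f.toIntLinearMap hf χ
  exact ⟨ψ, fun x => DFunLike.congr_fun hψ x⟩

theorem AddCharacter.eq_zero_of_forall {X : Type*} [AddCommGroup X] {x : X}
    (h : ∀ χ : AddCharacter X, χ x = 0) : x = 0 :=
  CharacterModule.eq_zero_of_character_apply h

/-- A character that vanishes on the kernel of `f` factors through `f`. -/
theorem AddCharacter.exists_factor {X Y : Type*} [AddCommGroup X] [AddCommGroup Y]
    (f : X →+ Y) (χ : AddCharacter X) (hχ : ∀ x, f x = 0 → χ x = 0) :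
    ∃ ψ : AddCharacter Y, ∀ x, ψ (f x) = χ x := by
  obtain ⟨ψ, hψ⟩ := exists_extension (QuotientAddGroup.kerLift f)
    (QuotientAddGroup.kerLift_injective f) (QuotientAddGroup.lift f.ker χ hχ)
  exact ⟨ψ, fun x => hψ (QuotientAddGroup.mk x)⟩

/-- Characters separate the points of the quotient by `N`. -/
theorem AddCharacter.mem_of_forall {X : Type*} [AddCommGroup X] (N : AddSubgroup X) {x : X}
    (h : ∀ χ : AddCharacter X, (∀ n ∈ N, χ n = 0) → χ x = 0) : x ∈ N := by
  rw [← QuotientAddGroup.eq_zero_iff]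
  refine eq_zero_of_forall fun χ => h (χ.comp (QuotientAddGroup.mk' N)) fun n hn => ?_
  rw [AddMonoidHom.comp_apply, QuotientAddGroup.mk'_apply, (QuotientAddGroup.eq_zero_iff n).2 hn,
    map_zero]

/-! ### Functors that are given by tensoring with a bimodule -/

/-- `F` is the functor of tensoring with the abelian group `M`, on which `S` acts, and on which
`R` acts from the opposite side through `act`. -/
structure TensorPresentation {R S : Type u} [Ring R] [Ring S]
    (F : ModuleCat.{u} R ⥤ ModuleCat.{u} S) (M : Type u) [AddCommGroup M] [Module S M]
    (act : R →+* (Module.End S M)ᵐᵒᵖ) where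
  /-- The pure tensors. -/
  tmul (X : ModuleCat.{u} R) : X →+ (M →ₗ[S] F.obj X)
  smul_tmul : ∀ {X : ModuleCat.{u} R} (r : R) (x : X) (m : M),
    tmul X (r • x) m = tmul X x ((act r).unop m)
  map_tmul : ∀ {X Y : ModuleCat.{u} R} (k : X ⟶ Y) (x : X) (m : M),
    F.map k (tmul X x m) = tmul Y (k x) m
  hom_ext : ∀ {X : ModuleCat.{u} R} {P : Type u} [AddCommGroup P] {f g : F.obj X →+ P},
    (∀ x m, f (tmul X x m) = g (tmul X x m)) → f = g
  -- `char_ext` and `exists_char` repeat the universal property for `ℚ/ℤ`, which lives in universe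
  -- `0` and not in `u`.
  char_ext : ∀ {X : ModuleCat.{u} R} {f g : AddCharacter (F.obj X)},
    (∀ x m, f (tmul X x m) = g (tmul X x m)) → f = g
  exists_lift : ∀ {X : ModuleCat.{u} R} {P : Type u} [AddCommGroup P] (b : X →+ M →+ P),
    (∀ r x m, b (r • x) m = b x ((act r).unop m)) →
      ∃ l : F.obj X →+ P, ∀ x m, l (tmul X x m) = b x m
  exists_char : ∀ {X : ModuleCat.{u} R} (b : X →+ AddCharacter M),
    (∀ r x m, b (r • x) m = b x ((act r).unop m)) →
      ∃ l : AddCharacter (F.obj X), ∀ x m, l (tmul X x m) = b x m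

/-- A family of forms that splits the map from `R` to the endomorphisms of `M` after passage to
characters, in terms of a dual basis of `M`. -/
structure SplittingForms {R S : Type u} [Ring R] [Ring S] {M : Type u} [AddCommGroup M]
    [Module S M] (act : R →+* (Module.End S M)ᵐᵒᵖ) where
  /-- The size of the dual basis. -/
  n : ℕ
  /-- The generators. -/
  basis : Fin n → M
  /-- The forms. -/
  form : Fin n → AddCharacter R →+ AddCharacter M
  form_act : ∀ i φ r m,
    form i φ ((act r).unop m) = form i (φ.comp (AddMonoidHom.mulRight r)) m
  sum_form : ∀ φ, ∑ i, form i φ (basis i) = φ 1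
  -- The matrix of `r` in the dual basis, moved from the basis to the forms. It carries equivariance
  -- on the second side; `form_act` carries the first.
  exchange : ∀ r, ∃ c : Fin n → Fin n → S,
    (∀ i, (act r).unop (basis i) = ∑ j, c i j • basis j) ∧
    ∀ φ m j, ∑ i, form i φ (c i j • m) = form j (φ.comp (AddMonoidHom.mulLeft r)) m

/-- The map `χ ↦ (x ↦ (r ↦ χ (r x)))`. -/
def AddCharacter.orbit (R X : Type*) [Ring R] [AddCommGroup X] [Module R X] :
    AddCharacter X →+ X →+ AddCharacter R :=
  AddMonoidHom.mk' (fun χ => AddMonoidHom.mk'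
      (fun x => AddMonoidHom.mk' (fun r => χ (r • x)) (fun r s => by simp [add_smul]))
      (fun x y => by ext r; simp))
    (fun χ ψ => by ext x r; simp)

@[simp]
theorem AddCharacter.orbit_apply {R X : Type*} [Ring R] [AddCommGroup X] [Module R X]
    (χ : AddCharacter X) (x : X) (r : R) : orbit R X χ x r = χ (r • x) := rfl

/-- The functor `Hom_S(M, -)`, on objects, with the action of `R` on the source. -/
def ActHom {R S : Type u} [Ring R] [Ring S] {M : Type u} [AddCommGroup M] [Module S M]
    (_act : R →+* (Module.End S M)ᵐᵒᵖ) (Z : Type u) [AddCommGroup Z] [Module S Z] : Type u :=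
  M →ₗ[S] Z

namespace ActHom

variable {R S : Type u} [Ring R] [Ring S] {M : Type u} [AddCommGroup M] [Module S M]
  (act : R →+* (Module.End S M)ᵐᵒᵖ) (Z : Type u) [AddCommGroup Z] [Module S Z]

instance : AddCommGroup (ActHom act Z) := inferInstanceAs (AddCommGroup (M →ₗ[S] Z))

instance : Module R (ActHom act Z) where
  smul r h := LinearMap.comp (show M →ₗ[S] Z from h) (act r).unop
  one_smul h := LinearMap.ext fun m => congrArg (show M →ₗ[S] Z from h) (by simp)
  mul_smul r s h := LinearMap.ext fun m => congrArg (show M →ₗ[S] Z from h) (by simp)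
  smul_zero r := rfl
  smul_add r h k := rfl
  add_smul r s h := LinearMap.ext fun m => by
    change (show M →ₗ[S] Z from h) ((act (r + s)).unop m) =
      (show M →ₗ[S] Z from h) ((act r).unop m) + (show M →ₗ[S] Z from h) ((act s).unop m)
    rw [← map_add]
    simp
  zero_smul h := LinearMap.ext fun m => by
    change (show M →ₗ[S] Z from h) ((act 0).unop m) = 0
    rw [map_zero, unop_zero, LinearMap.zero_apply, map_zero]

end ActHom

/-! ### The tensor-Hom adjunction. -/

namespace TensorPresentation

variable {R S : Type u} [Ring R] [Ring S] {F : ModuleCat.{u} R ⥤ ModuleCat.{u} S}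
  {M : Type u} [AddCommGroup M] [Module S M] {act : R →+* (Module.End S M)ᵐᵒᵖ}
  (T : TensorPresentation F M act)

theorem linear_ext {X : ModuleCat.{u} R} {Z : ModuleCat.{u} S} {f g : F.obj X ⟶ Z}
    (h : ∀ x m, f (T.tmul X x m) = g (T.tmul X x m)) : f = g := by
  ext t
  exact DFunLike.congr_fun (T.hom_ext (f := f.hom.toAddMonoidHom) (g := g.hom.toAddMonoidHom) h) t

/-- Currying along the pure tensors. -/
def curry (X : ModuleCat.{u} R) (Z : ModuleCat.{u} S) (g : F.obj X ⟶ Z) :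
    X ⟶ ModuleCat.of R (ActHom act Z) :=
  ModuleCat.ofHom
    { toFun := fun x => (LinearMap.comp g.hom (T.tmul X x) : M →ₗ[S] Z)
      map_add' := fun x y => LinearMap.ext fun m => by simp; rfl
      map_smul' := fun r x => LinearMap.ext fun m => congrArg g.hom (T.smul_tmul r x m) }

theorem curry_bijective (X : ModuleCat.{u} R) (Z : ModuleCat.{u} S) :
    Function.Bijective (T.curry X Z) := by
  refine ⟨fun f g h => T.linear_ext fun x m => ?_, fun k => ?_⟩
  · exact LinearMap.congr_fun
      (show (show M →ₗ[S] Z from T.curry X Z f x) = T.curry X Z g x by rw [h]) m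
  · let b : X →+ M →+ Z := AddMonoidHom.mk'
      (fun x => (show M →ₗ[S] Z from k x).toAddMonoidHom)
      (fun x y => by
        ext m
        exact LinearMap.congr_fun (show (show M →ₗ[S] Z from k (x + y)) = k x + k y from
          map_add k.hom x y) m)
    obtain ⟨l, hl⟩ := T.exists_lift b fun r x m =>
      LinearMap.congr_fun (show (show M →ₗ[S] Z from k (r • x)) = r • k x from
          map_smul k.hom r x) m
    -- The lift is only additive so far; its `S`-linearity is an equality of additive maps, checked
    -- on pure tensors.
    refine ⟨ModuleCat.ofHom { l with map_smul' := fun s t => ?_ }, ?_⟩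
    · refine DFunLike.congr_fun (T.hom_ext
        (f := l.comp (DistribSMul.toAddMonoidHom (F.obj X) s))
        (g := (DistribSMul.toAddMonoidHom Z s).comp l) fun x m => ?_) t
      change l (s • T.tmul X x m) = s • l (T.tmul X x m)
      rw [← map_smul, hl, hl]
      exact map_smul (show M →ₗ[S] Z from k x) s m
    · ext x
      exact LinearMap.ext fun m => hl x m

/-- The adjunction between tensoring with `M` and `Hom_S(M, -)`. -/
noncomputable def adjunction : F ⊣ Adjunction.rightAdjointOfEquiv
    (fun X Z => Equiv.ofBijective (T.curry X Z) (T.curry_bijective X Z))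
    (fun X' X Z f g => by
      ext x
      exact LinearMap.ext fun m => congrArg g.hom (T.map_tmul f x m)) :=
  Adjunction.adjunctionOfEquivRight _ _

/-! ### Splitting the unit on characters. -/

variable (D : SplittingForms act)

theorem exists_evalChar (X : ModuleCat.{u} R) (i : Fin D.n) (χ : AddCharacter X) :
    ∃ l : AddCharacter (F.obj X),
      ∀ x m, l (T.tmul X x m) = D.form i (AddCharacter.orbit R X χ x) m :=
  T.exists_char ((D.form i).comp (AddCharacter.orbit R X χ)) fun r x m => by
    simp only [AddMonoidHom.comp_apply]
    rw [D.form_act]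
    congr 2
    ext s
    simp [mul_smul]

/-- The character of `X ⊗ M` that a form and a character of `X` define. -/
noncomputable def evalChar (X : ModuleCat.{u} R) (i : Fin D.n) (χ : AddCharacter X) :
    AddCharacter (F.obj X) :=
  (T.exists_evalChar D X i χ).choose

theorem evalChar_tmul (X : ModuleCat.{u} R) (i : Fin D.n) (χ : AddCharacter X) (x : X) (m : M) :
    T.evalChar D X i χ (T.tmul X x m) = D.form i (AddCharacter.orbit R X χ x) m :=
  (T.exists_evalChar D X i χ).choose_spec x m

theorem evalChar_add (X : ModuleCat.{u} R) (i : Fin D.n) (χ ψ : AddCharacter X) :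
    T.evalChar D X i (χ + ψ) = T.evalChar D X i χ + T.evalChar D X i ψ :=
  T.char_ext fun x m => by simp [evalChar_tmul]

theorem evalChar_map {X Y : ModuleCat.{u} R} (k : X ⟶ Y) (i : Fin D.n) (χ : AddCharacter Y)
    (t : F.obj X) :
    T.evalChar D X i (χ.comp k.hom.toAddMonoidHom) t = T.evalChar D Y i χ (F.map k t) := by
  refine DFunLike.congr_fun (T.char_ext (g := (T.evalChar D Y i χ).comp
    (F.map k).hom.toAddMonoidHom) fun x m => ?_) t
  change _ = T.evalChar D Y i χ (F.map k (T.tmul X x m))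
  rw [T.map_tmul, evalChar_tmul, evalChar_tmul]
  congr 2
  ext r
  simp

/-- The splitting of the map from characters of `Hom_S(M, X ⊗ M)` to characters of `X`. -/
noncomputable def splitChar (X : ModuleCat.{u} R) :
    AddCharacter X →+ AddCharacter (M →ₗ[S] F.obj X) :=
  AddMonoidHom.mk' (fun χ => AddMonoidHom.mk'
      (fun h => ∑ i, T.evalChar D X i χ (h (D.basis i)))
      (fun h k => by simp [Finset.sum_add_distrib]))
    (fun χ ψ => by ext h; simp [evalChar_add, Finset.sum_add_distrib])

theorem splitChar_apply (X : ModuleCat.{u} R) (χ : AddCharacter X) (h : M →ₗ[S] F.obj X) :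
    T.splitChar D X χ h = ∑ i, T.evalChar D X i χ (h (D.basis i)) := rfl

theorem splitChar_tmul (X : ModuleCat.{u} R) (χ : AddCharacter X) (x : X) :
    T.splitChar D X χ (T.tmul X x) = χ x := by
  simp [splitChar_apply, evalChar_tmul, D.sum_form]

theorem splitChar_map {X Y : ModuleCat.{u} R} (k : X ⟶ Y) (χ : AddCharacter Y)
    (h : M →ₗ[S] F.obj X) :
    T.splitChar D X (χ.comp k.hom.toAddMonoidHom) h =
      T.splitChar D Y χ ((F.map k).hom ∘ₗ h) := by
  simp only [splitChar_apply, evalChar_map]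
  rfl

/-- This is where two-sidedness is used: `exchange` trades the action on `χ` for the action on the
argument of `h`. It is what makes the biadditive maps built from `splitChar` balanced. -/
theorem splitChar_act (X : ModuleCat.{u} R) (r : R) (χ : AddCharacter X)
    (h : M →ₗ[S] F.obj X) :
    T.splitChar D X (χ.comp (DistribSMul.toAddMonoidHom X r)) h =
      T.splitChar D X χ (h ∘ₗ (act r).unop) := by
  obtain ⟨c, hc, hc'⟩ := D.exchange r
  have key (j : Fin D.n) : T.evalChar D X j (χ.comp (DistribSMul.toAddMonoidHom X r)) =
      ∑ i, (T.evalChar D X i χ).comp (DistribSMul.toAddMonoidHom (F.obj X) (c i j)) := by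
    refine T.char_ext fun x m => ?_
    simp only [AddMonoidHom.finsetSum_apply, AddMonoidHom.comp_apply,
      DistribSMul.toAddMonoidHom_apply, ← map_smul, evalChar_tmul]
    rw [hc']
    congr 2
    ext s
    simp [mul_smul]
  simp only [splitChar_apply, key, LinearMap.comp_apply, hc, map_sum, map_smul,
    AddMonoidHom.finsetSum_apply, AddMonoidHom.comp_apply, DistribSMul.toAddMonoidHom_apply]
  exact Finset.sum_comm

include D in
theorem tmul_injective (X : ModuleCat.{u} R) : Function.Injective (T.tmul X) := by
  refine (injective_iff_map_eq_zero _).2 fun x hx => AddCharacter.eq_zero_of_forall fun χ => ?_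
  rw [← T.splitChar_tmul D, hx, map_zero]

include T D in
theorem faithful : F.Faithful where
  map_injective {X Y} f g h := by
    ext x
    refine T.tmul_injective D Y (LinearMap.ext fun m => ?_)
    rw [← T.map_tmul, ← T.map_tmul, h]

end TensorPresentation

/-! ### Equalizers of cosplit pairs. -/

namespace TensorPresentation

variable {R S : Type u} [Ring R] [Ring S] {F : ModuleCat.{u} R ⥤ ModuleCat.{u} S}
  {M : Type u} [AddCommGroup M] [Module S M] {act : R →+* (Module.End S M)ᵐᵒᵖ}
  (T : TensorPresentation F M act) (D : SplittingForms act)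

/-- Such a `χ` factors as `ψ ∘ (f - g)`, so by naturality its value at `h` is the difference of the
values of `ψ` at two equal maps. Thus, on maps into the equalizer of `F.map f` and `F.map g`,
`splitChar` depends only on the restriction of the character to the equalizer of `f` and `g`. -/
theorem splitChar_eq_zero {X Y : ModuleCat.{u} R} (f g : X ⟶ Y) (χ : AddCharacter X)
    (hχ : ∀ x, f x = g x → χ x = 0) (h : M →ₗ[S] F.obj X)
    (hh : ∀ m, F.map f (h m) = F.map g (h m)) : T.splitChar D X χ h = 0 := by
  obtain ⟨ψ, hψ⟩ := AddCharacter.exists_factor (f.hom - g.hom).toAddMonoidHom χ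
    fun x hx => hχ x (sub_eq_zero.1 hx)
  have e : χ = ψ.comp f.hom.toAddMonoidHom - ψ.comp g.hom.toAddMonoidHom := by
    ext x
    rw [← hψ]
    exact map_sub ψ _ _
  rw [e, map_sub, AddMonoidHom.sub_apply, splitChar_map, splitChar_map, sub_eq_zero]
  congr 1
  ext m
  exact hh m

section Equalizer

variable {X Y : ModuleCat.{u} R} {f g : X ⟶ Y} {Z : ModuleCat.{u} S} {ι : Z ⟶ F.obj X}
  (s : IsSplitEqualizer (F.map f) (F.map g) ι)

/-- The inclusion of the equalizer of two module homomorphisms. -/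
def eqInclusion (f g : X ⟶ Y) : ModuleCat.of R (LinearMap.eqLocus f.hom g.hom) ⟶ X :=
  ModuleCat.ofHom (LinearMap.eqLocus f.hom g.hom).subtype

include T D s in
-- Every character of `F` of the equalizer extends to `F.obj X`, and characters separate points.
theorem map_eqInclusion_injective : Function.Injective (F.map (eqInclusion f g)) := by
  -- `p` maps into the equalizer of `F.map f` and `F.map g`, and it fixes pure tensors coming from
  -- the equalizer of `f` and `g`.
  let p : F.obj X →ₗ[S] F.obj X := (F.map f ≫ s.rightRetraction).hom
  have hp (t) : F.map f (p t) = F.map g (p t) := by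
    have e : (F.map f ≫ s.rightRetraction) ≫ F.map f =
        (F.map f ≫ s.rightRetraction) ≫ F.map g := by
      rw [s.top_rightRetraction, Category.assoc, Category.assoc, s.condition]
    exact ConcreteCategory.congr_hom e t
  have hp' (n : LinearMap.eqLocus f.hom g.hom) (m) : p (T.tmul X n m) = T.tmul X n m := by
    change s.rightRetraction (F.map f (T.tmul X n m)) = _
    rw [T.map_tmul, show f (n : X) = g (n : X) from n.2, ← T.map_tmul]
    exact ConcreteCategory.congr_hom s.bottom_rightRetraction _
  refine (injective_iff_map_eq_zero (F.map (eqInclusion f g)).hom).2 fun t ht =>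
    AddCharacter.eq_zero_of_forall fun χ => ?_
  have hext (m : M) : ∃ e : AddCharacter X, ∀ n : LinearMap.eqLocus f.hom g.hom,
      e n = χ (T.tmul (.of R (LinearMap.eqLocus f.hom g.hom)) n m) :=
    AddCharacter.exists_extension (LinearMap.eqLocus f.hom g.hom).subtype.toAddMonoidHom
      Subtype.val_injective
      (AddMonoidHom.mk' (fun n => χ (T.tmul (.of R (LinearMap.eqLocus f.hom g.hom)) n m))
        (fun a b => by simp))
  choose e he using hext
  -- The extensions `e m` are arbitrary choices, neither additive nor equivariant in `m`. Since `p`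
  -- maps into the equalizer, the choice does not matter after `splitChar`; additivity and
  -- balancedness of `b` follow.
  have vanish (d : AddCharacter X) (hd : ∀ n : LinearMap.eqLocus f.hom g.hom, d n = 0) (x : X) :
      T.splitChar D X d (p ∘ₗ T.tmul X x) = 0 :=
    T.splitChar_eq_zero D f g d (fun y hy => hd ⟨y, hy⟩) _ fun m => hp _
  let b : X →+ AddCharacter M := AddMonoidHom.mk'
    (fun x => AddMonoidHom.mk' (fun m => T.splitChar D X (e m) (p ∘ₗ T.tmul X x))
      (fun m m' => by
        have := vanish (e (m + m') - (e m + e m')) (fun n => by simp [he]) x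
        rw [map_sub, map_add, AddMonoidHom.sub_apply, sub_eq_zero] at this
        exact this))
    (fun x y => by
      ext m
      simp [LinearMap.comp_add])
  obtain ⟨l, hl⟩ := T.exists_char b fun r x m => by
    change T.splitChar D X (e m) (p ∘ₗ T.tmul X (r • x)) =
      T.splitChar D X (e ((act r).unop m)) (p ∘ₗ T.tmul X x)
    have h₁ : p ∘ₗ T.tmul X (r • x) = (p ∘ₗ T.tmul X x) ∘ₗ (act r).unop := by
      ext m'
      simp [T.smul_tmul]
    have := vanish ((e m).comp (DistribSMul.toAddMonoidHom X r) - e ((act r).unop m)) (fun n => by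
      have := he m (r • n)
      rw [T.smul_tmul] at this
      simpa [he, sub_eq_zero] using this) x
    rw [map_sub, AddMonoidHom.sub_apply, sub_eq_zero] at this
    rw [h₁, ← T.splitChar_act D, this]
  have hχ : l.comp (F.map (eqInclusion f g)).hom.toAddMonoidHom = χ := by
    refine T.char_ext fun n m => ?_
    change l (F.map (eqInclusion f g) (T.tmul _ n m)) = _
    rw [T.map_tmul, hl]
    change T.splitChar D X (e m) (p ∘ₗ T.tmul X (n : X)) = _
    rw [show p ∘ₗ T.tmul X (n : X) = T.tmul X n from LinearMap.ext (hp' n), T.splitChar_tmul, he]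
  rw [← hχ]
  exact (congrArg l ht).trans (map_zero l)

include T D s in
-- A character `ω` that kills the range has the form `l ∘ F.map g` with `l ∘ F.map f = 0`, so it
-- kills `t`.
theorem mem_range_map_eqInclusion (t : F.obj X) (ht : F.map f t = F.map g t) :
    ∃ n, F.map (eqInclusion f g) n = t := by
  refine AddCharacter.mem_of_forall (F.map (eqInclusion f g)).hom.toAddMonoidHom.range
    fun ω hω => ?_
  let w : M →+ AddCharacter X := AddMonoidHom.mk'
    (fun m => AddMonoidHom.mk' (fun x => ω (T.tmul X x m)) (fun x y => by simp))
    (fun m m' => by ext x; simp)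
  have hw (m x) : w m x = ω (T.tmul X x m) := rfl
  -- `l` comes from applying `splitChar` to `x ↦ ω (x ⊗ m)` along the right retraction. The
  -- retraction undoes `F.map g`, which recovers `ω`; after `F.map f` it lands in the equalizer,
  -- where `splitChar_eq_zero` applies.
  let b : Y →+ AddCharacter M := AddMonoidHom.mk'
    (fun y => AddMonoidHom.mk'
      (fun m => T.splitChar D X (w m) (s.rightRetraction.hom ∘ₗ T.tmul Y y))
      (fun m m' => by simp))
    (fun x y => by
      ext m
      simp [LinearMap.comp_add])
  obtain ⟨l, hl⟩ := T.exists_char b fun r y m => by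
    change T.splitChar D X (w m) (s.rightRetraction.hom ∘ₗ T.tmul Y (r • y)) =
      T.splitChar D X (w ((act r).unop m)) (s.rightRetraction.hom ∘ₗ T.tmul Y y)
    have h₁ : s.rightRetraction.hom ∘ₗ T.tmul Y (r • y) =
        (s.rightRetraction.hom ∘ₗ T.tmul Y y) ∘ₗ (act r).unop := by
      ext m'
      simp [T.smul_tmul]
    rw [h₁, ← T.splitChar_act D]
    congr 2
    ext x
    simp [hw, T.smul_tmul]
  have key : l.comp (F.map g).hom.toAddMonoidHom =
      ω + l.comp (F.map f).hom.toAddMonoidHom := by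
    refine T.char_ext fun x m => ?_
    change l (F.map g (T.tmul X x m)) = ω (T.tmul X x m) + l (F.map f (T.tmul X x m))
    rw [T.map_tmul, T.map_tmul, hl, hl]
    change T.splitChar D X (w m) (s.rightRetraction.hom ∘ₗ T.tmul Y (g x)) =
      _ + T.splitChar D X (w m) (s.rightRetraction.hom ∘ₗ T.tmul Y (f x))
    have h₁ : s.rightRetraction.hom ∘ₗ T.tmul Y (g x) = T.tmul X x := by
      ext m
      change s.rightRetraction (T.tmul Y (g x) m) = _
      rw [← T.map_tmul]
      exact ConcreteCategory.congr_hom s.bottom_rightRetraction _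
    rw [h₁, T.splitChar_tmul, hw, left_eq_add]
    refine T.splitChar_eq_zero D f g _ (fun x hx => ?_) _ fun m => ?_
    · rw [hw]
      refine hω _ ⟨T.tmul (.of R (LinearMap.eqLocus f.hom g.hom)) ⟨x, hx⟩ m, ?_⟩
      exact T.map_tmul (eqInclusion f g) ⟨x, hx⟩ m
    · change F.map f (s.rightRetraction (T.tmul Y (f x) m)) =
        F.map g (s.rightRetraction (T.tmul Y (f x) m))
      rw [← T.map_tmul]
      have e : (F.map f ≫ s.rightRetraction) ≫ F.map f =
          (F.map f ≫ s.rightRetraction) ≫ F.map g := by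
        rw [s.top_rightRetraction, Category.assoc, Category.assoc, s.condition]
      exact ConcreteCategory.congr_hom e _
  have := DFunLike.congr_fun key t
  change l (F.map g t) = ω t + l (F.map f t) at this
  rw [ht] at this
  exact right_eq_add.1 this

end Equalizer

/-! ### Beck's comonadicity criterion. -/

open Limits

theorem eqInclusion_condition {X Y : ModuleCat.{u} R} (f g : X ⟶ Y) :
    eqInclusion f g ≫ f = eqInclusion f g ≫ g := by
  ext n
  exact n.2

/-- The inclusion of the equalizer is an equalizer. -/
def eqInclusionIsLimit {X Y : ModuleCat.{u} R} (f g : X ⟶ Y) :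
    IsLimit (Fork.ofι (eqInclusion f g) (eqInclusion_condition f g)) :=
  Fork.IsLimit.mk _
    (fun c => ModuleCat.ofHom (c.ι.hom.codRestrict (LinearMap.eqLocus f.hom g.hom)
      fun x => ConcreteCategory.congr_hom c.condition x))
    (fun c => by ext x; rfl)
    (fun c k hk => by
      ext x
      exact Subtype.ext (ConcreteCategory.congr_hom hk x))

include T D in
theorem preservesLimit_of_isCosplitPair {X Y : ModuleCat.{u} R} (f g : X ⟶ Y)
    [h : F.IsCosplitPair f g] : PreservesLimit (parallelPair f g) F := by
  obtain ⟨Z, ι, ⟨s⟩⟩ := h.splittable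
  let j := (F.map (eqInclusion f g)).hom
  have hj : Function.Injective j := T.map_eqInclusion_injective D s
  refine preservesLimit_of_preserves_limit_cone (eqInclusionIsLimit f g) ?_
  refine (isLimitMapConeForkEquiv F (eqInclusion_condition f g)).symm ?_
  refine Fork.IsLimit.mk _
    (fun c => ModuleCat.ofHom ((LinearEquiv.ofInjective j hj).symm.toLinearMap ∘ₗ
      c.ι.hom.codRestrict (LinearMap.range j) fun x => T.mem_range_map_eqInclusion D s _
        (ConcreteCategory.congr_hom c.condition x)))
    (fun c => ?_) (fun c k hk => ?_)
  · ext x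
    exact congrArg Subtype.val ((LinearEquiv.ofInjective j hj).apply_symm_apply _)
  · ext x
    refine hj ((ConcreteCategory.congr_hom hk x).trans ?_)
    exact (congrArg Subtype.val ((LinearEquiv.ofInjective j hj).apply_symm_apply
      ⟨c.ι x, _⟩)).symm

include T D in
theorem isComonadic : IsComonadic F := by
  have : F.Faithful := T.faithful D
  have : F.ReflectsIsomorphisms := inferInstance
  have : Comonad.PreservesLimitOfIsCosplitPair F :=
    ⟨fun f g _ => T.preservesLimit_of_isCosplitPair D f g⟩
  have : Comonad.HasEqualizerOfIsCosplitPair F := ⟨fun f g _ => inferInstance⟩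
  exact ⟨Comonad.comonadicOfHasPreservesFSplitEqualizersOfReflectsIsomorphisms T.adjunction⟩

end TensorPresentation

/-- Up to isomorphism `F` is an equivalence followed by the forgetful functor from coalgebras, which
is faithful. -/
theorem IsComonadic.faithful {C D : Type*} [Category C] [Category D] {F : C ⥤ D}
    (h : IsComonadic F) : F.Faithful := by
  obtain ⟨h⟩ := h
  have := h.eqv
  exact Functor.Faithful.of_iso (Comonad.comparisonForget h.adj)

/-- A comonadic functor of tensoring with `M` detects elements. -/
theorem TensorPresentation.tmul_injective_of_isComonadic {R S : Type u} [Ring R] [Ring S]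
    {F : ModuleCat.{u} R ⥤ ModuleCat.{u} S} {M : Type u} [AddCommGroup M] [Module S M]
    {act : R →+* (Module.End S M)ᵐᵒᵖ} (T : TensorPresentation F M act) (h : IsComonadic F)
    (X : ModuleCat.{u} R) : Function.Injective (T.tmul X) := by
  have := h.faithful
  refine (injective_iff_map_eq_zero _).2 fun x hx => ?_
  let k (y : X) : ModuleCat.of R R ⟶ X := ModuleCat.ofHom (LinearMap.toSpanSingleton R X y)
  have hk : k x = k 0 := F.map_injective <| T.linear_ext fun r m => by
    rw [T.map_tmul, T.map_tmul]
    change T.tmul X (r • x) m = T.tmul X (r • (0 : X)) m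
    rw [T.smul_tmul, T.smul_tmul, hx, map_zero]
  simpa [k] using ConcreteCategory.congr_hom hk (1 : R)

/-! ### Averaging over a separability element -/

open AddMonoidHom (mulLeft mulRight)

/-- Projectivity splits the multiplication map `μ`, and `e` is the image of `1` under the section.
Both `a ⊗ 1` and `1 ⊗ op a` send `1` to `a`, so they agree on `e`. -/
theorem IsSeparableAlgebra.exists_element {K A : Type*} [CommRing K] [Ring A] [Algebra K A]
    (h : IsSeparableAlgebra K A) :
    ∃ (e : A ⊗[K] Aᵐᵒᵖ) (μ : A ⊗[K] Aᵐᵒᵖ →+ A),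
      (∀ a : A, (a ⊗ₜ[K] 1) * e = ((1 : A) ⊗ₜ[K] op a) * e) ∧
      (∀ a a', μ (a ⊗ₜ a') = a * a'.unop) ∧ μ e = 1 := by
  let _ : Module (A ⊗[K] Aᵐᵒᵖ) A := TensorProduct.Algebra.module
  have hp : Module.Projective (A ⊗[K] Aᵐᵒᵖ) A := h
  let μ := LinearMap.toSpanSingleton (A ⊗[K] Aᵐᵒᵖ) A 1
  obtain ⟨σ, hσ⟩ := Module.projective_lifting_property μ LinearMap.id (fun a => ⟨a ⊗ₜ[K] 1, by
      simp [μ, TensorProduct.Algebra.smul_def]⟩)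
  refine ⟨σ 1, μ.toAddMonoidHom, fun a => ?_, fun a a' => ?_, LinearMap.congr_fun hσ 1⟩
  · rw [← smul_eq_mul, ← smul_eq_mul, ← map_smul, ← map_smul]
    simp [TensorProduct.Algebra.smul_def]
  · simp [μ, TensorProduct.Algebra.smul_def]

section Averaging

variable {K A E : Type*} [CommRing K] [Ring A] [Algebra K A] [Ring E] (i : A →+* E)
  (hi : ∀ (k : K) (e : E), i (algebraMap K A k) * e = e * i (algebraMap K A k))

include hi in
/-- Averaging over a separability element makes a right linear splitting two-sided. -/
theorem exists_splitting_of_right (hsep : IsSeparableAlgebra K A)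
    (s : AddCharacter A →+ AddCharacter E)
    (hs : ∀ φ a e, s (φ.comp (mulLeft a)) e = s φ (i a * e))
    (hs' : ∀ φ a, s φ (i a) = φ a) :
    ∃ s : AddCharacter A →+ AddCharacter E,
      (∀ φ a e, s (φ.comp (mulLeft a)) e = s φ (i a * e)) ∧
      (∀ φ a e, s (φ.comp (mulRight a)) e = s φ (e * i a)) ∧ ∀ φ a, s φ (i a) = φ a := by
  -- `J (a ⊗ a')` twists `s` by `a'` on the source and `a` on the target. Balancedness over `K`
  -- holds since scalars are central in `A` and, by `hi`, their images commute with `E`.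
  let J : A ⊗[K] Aᵐᵒᵖ →+ AddCharacter A →+ AddCharacter E := TensorProduct.liftAddHom
    (AddMonoidHom.mk' (fun a => AddMonoidHom.mk' (fun a' => AddMonoidHom.mk'
        (fun φ => (s (φ.comp (mulRight a'.unop))).comp (mulRight (i a)))
        (fun φ ψ => by ext e; simp [AddMonoidHom.add_comp]))
      (fun a' b' => by
        ext φ e
        change s (φ.comp (mulRight (a' + b').unop)) (e * i a) =
          s (φ.comp (mulRight a'.unop)) (e * i a) + s (φ.comp (mulRight b'.unop)) (e * i a)
        rw [← AddMonoidHom.add_apply, ← map_add]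
        congr 2
        ext x
        simp [mul_add]))
      (fun a b => by ext a' φ e; simp [mul_add]))
    (fun k a a' => by
      ext φ e
      change s (φ.comp (mulRight a'.unop)) (e * i (k • a)) =
        s (φ.comp (mulRight (k • a').unop)) (e * i a)
      have : φ.comp (mulRight (k • a').unop) =
          (φ.comp (mulRight a'.unop)).comp (mulLeft (algebraMap K A k)) := by
        ext x
        simp [Algebra.smul_def, Algebra.commutes, mul_assoc]
      rw [this, hs, Algebra.smul_def, map_mul i, ← mul_assoc, ← mul_assoc, hi])
  have hJ (a : A) (a' : Aᵐᵒᵖ) (φ e) : J (a ⊗ₜ a') φ e = s (φ.comp (mulRight a'.unop)) (e * i a) := rfl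
  obtain ⟨ε, μ, hε, hμ, hε'⟩ := hsep.exists_element
  have h₁ (b : A) (t φ e) : J ((b ⊗ₜ[K] 1) * t) φ e = J t φ (e * i b) := by
    induction t using TensorProduct.induction_on with
    | zero => simp
    | tmul a a' =>
      rw [Algebra.TensorProduct.tmul_mul_tmul, one_mul, hJ, hJ, map_mul i, mul_assoc]
    | add t t' h h' => simp only [mul_add, map_add, AddMonoidHom.add_apply, h, h']
  have h₂ (b : A) (t φ e) : J ((1 ⊗ₜ[K] op b) * t) φ e = J t (φ.comp (mulRight b)) e := by
    induction t using TensorProduct.induction_on with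
    | zero => simp
    | tmul a a' =>
      rw [Algebra.TensorProduct.tmul_mul_tmul, one_mul, hJ, hJ]
      congr 2
      ext x
      simp [mul_assoc]
    | add t t' h h' => simp only [mul_add, map_add, AddMonoidHom.add_apply, h, h']
  have h₃ (b : A) (t φ e) : J t (φ.comp (mulLeft b)) e = J t φ (i b * e) := by
    induction t using TensorProduct.induction_on with
    | zero => simp
    | tmul a a' =>
      rw [hJ, hJ, mul_assoc, ← hs]
      congr 2
      ext x
      simp [mul_assoc]
    | add t t' h h' => simp only [map_add, AddMonoidHom.add_apply, h, h']
  have h₄ (x : A) (t φ) : J t φ (i x) = φ (x * μ t) := by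
    induction t using TensorProduct.induction_on with
    | zero => simp
    | tmul a a' =>
      rw [hJ, ← map_mul, hs', hμ]
      simp [mul_assoc]
    | add t t' h h' => simp only [map_add, AddMonoidHom.add_apply, h, h', mul_add]
  -- `hε` turns the twist on the target into the twist on the source, giving the missing
  -- equivariance; `μ ε = 1` keeps the splitting property.
  exact ⟨J ε, fun φ a e => h₃ _ _ _ _, fun φ a e => by rw [← h₁, hε, h₂],
    fun φ a => by rw [h₄, hε', mul_one]⟩

include hi in
/-- Averaging over a separability element makes a left linear splitting two-sided. -/
theorem exists_splitting_of_left (hsep : IsSeparableAlgebra K A)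
    (s : AddCharacter A →+ AddCharacter E)
    (hs : ∀ φ a e, s (φ.comp (mulRight a)) e = s φ (e * i a))
    (hs' : ∀ φ a, s φ (i a) = φ a) :
    ∃ s : AddCharacter A →+ AddCharacter E,
      (∀ φ a e, s (φ.comp (mulLeft a)) e = s φ (i a * e)) ∧
      (∀ φ a e, s (φ.comp (mulRight a)) e = s φ (e * i a)) ∧ ∀ φ a, s φ (i a) = φ a := by
  let J : A ⊗[K] Aᵐᵒᵖ →+ AddCharacter A →+ AddCharacter E := TensorProduct.liftAddHom
    (AddMonoidHom.mk' (fun a => AddMonoidHom.mk' (fun a' : Aᵐᵒᵖ => AddMonoidHom.mk'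
        (fun φ => (s (φ.comp (mulLeft a))).comp (mulLeft (i a'.unop)))
        (fun φ ψ => by ext e; simp [AddMonoidHom.add_comp]))
      (fun a' b' => by ext φ e; simp [add_mul]))
      (fun a b => by
        refine AddMonoidHom.ext fun a' => ?_
        ext φ e
        change s (φ.comp (mulLeft (a + b))) (i a'.unop * e) =
          s (φ.comp (mulLeft a)) (i a'.unop * e) + s (φ.comp (mulLeft b)) (i a'.unop * e)
        rw [← AddMonoidHom.add_apply, ← map_add]
        congr 2
        ext x
        simp [add_mul]))
    (fun k a a' => by
      ext φ e
      change s (φ.comp (mulLeft (k • a))) (i a'.unop * e) =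
        s (φ.comp (mulLeft a)) (i (k • a').unop * e)
      have : φ.comp (mulLeft (k • a)) =
          (φ.comp (mulLeft a)).comp (mulRight (algebraMap K A k)) := by
        ext x
        simp [Algebra.smul_def, Algebra.commutes, mul_assoc]
      rw [this, hs, unop_smul, Algebra.smul_def, map_mul i, hi, mul_assoc, mul_assoc, hi])
  have hJ (a : A) (a' : Aᵐᵒᵖ) (φ e) : J (a ⊗ₜ a') φ e = s (φ.comp (mulLeft a)) (i a'.unop * e) := rfl
  obtain ⟨ε, μ, hε, hμ, hε'⟩ := hsep.exists_element
  have h₁ (b : A) (t φ e) : J ((b ⊗ₜ[K] 1) * t) φ e = J t (φ.comp (mulLeft b)) e := by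
    induction t using TensorProduct.induction_on with
    | zero => simp
    | tmul a a' =>
      rw [Algebra.TensorProduct.tmul_mul_tmul, one_mul, hJ, hJ]
      congr 2
      ext x
      simp [mul_assoc]
    | add t t' h h' => simp only [mul_add, map_add, AddMonoidHom.add_apply, h, h']
  have h₂ (b : A) (t φ e) : J ((1 ⊗ₜ[K] op b) * t) φ e = J t φ (i b * e) := by
    induction t using TensorProduct.induction_on with
    | zero => simp
    | tmul a a' =>
      rw [Algebra.TensorProduct.tmul_mul_tmul, one_mul, hJ, hJ, unop_mul, unop_op, map_mul i,
        mul_assoc]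
    | add t t' h h' => simp only [mul_add, map_add, AddMonoidHom.add_apply, h, h']
  have h₃ (b : A) (t φ e) : J t (φ.comp (mulRight b)) e = J t φ (e * i b) := by
    induction t using TensorProduct.induction_on with
    | zero => simp
    | tmul a a' =>
      rw [hJ, hJ, ← mul_assoc, ← hs]
      congr 2
      ext x
      simp [mul_assoc]
    | add t t' h h' => simp only [map_add, AddMonoidHom.add_apply, h, h']
  have h₄ (x : A) (t φ) : J t φ (i x) = φ (μ t * x) := by
    induction t using TensorProduct.induction_on with
    | zero => simp
    | tmul a a' =>
      rw [hJ, ← map_mul, hs', hμ]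
      simp [mul_assoc]
    | add t t' h h' => simp only [map_add, AddMonoidHom.add_apply, h, h', add_mul]
  exact ⟨J ε, fun φ a e => by rw [← h₂, ← hε, h₁], fun φ a e => h₃ _ _ _ _,
    fun φ a => by rw [h₄, hε', one_mul]⟩

end Averaging

/-- The character bimodule map of a ring homomorphism splits if and only if there is an equivariant
extension of characters. -/
theorem isSplitEpi_map_hom_iff {A E : Type*} [Ring A] [Ring E] (i : A →+* E) :
    (CharacterBimodule.map (AlongHom.hom i)).IsSplitEpi ↔
      ∃ s : AddCharacter A →+ AddCharacter E,
        (∀ φ a e, s (φ.comp (mulLeft a)) e = s φ (i a * e)) ∧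
        (∀ φ a e, s (φ.comp (mulRight a)) e = s φ (e * i a)) ∧ ∀ φ a, s φ (i a) = φ a := by
  constructor
  · rintro ⟨s, hs⟩
    exact ⟨s.toAddMonoidHom, fun φ a e => DFunLike.congr_fun (F := AddCharacter E)
        (s.map_op_smul' a φ) e,
      fun φ a e => DFunLike.congr_fun (F := AddCharacter E) (s.map_smul' a φ) e,
      fun φ a => DFunLike.congr_fun (F := AddCharacter A) (hs φ) a⟩
  · rintro ⟨s, h₁, h₂, h₃⟩
    exact ⟨{ (show CharacterBimodule A →+ CharacterBimodule (AlongHom i) from s) with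
        map_smul' := fun a φ => AddMonoidHom.ext fun e => h₂ φ a e
        map_op_smul' := fun a φ => AddMonoidHom.ext fun e => h₁ φ a e },
      fun φ => AddMonoidHom.ext fun a => h₃ φ a⟩

/-! ### From an injective unit to a one-sided splitting. -/

namespace TensorPresentation

variable {R S : Type u} [Ring R] [Ring S] {F : ModuleCat.{u} R ⥤ ModuleCat.{u} S}
  {M : Type u} [AddCommGroup M] [Module S M] {act : R →+* (Module.End S M)ᵐᵒᵖ}
  (T : TensorPresentation F M act)

include T in
/-- If tensoring with `M` detects the elements of the character module of `R`, then characters of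
`R` extend equivariantly to the endomorphism ring of `M`. -/
theorem exists_extension
    (h : Function.Injective (T.tmul (ModuleCat.of R (CharacterBimodule R)))) :
    ∃ s : AddCharacter R →+ AddCharacter (Module.End S M),
      (∀ φ r e, s (φ.comp (mulRight r)) e = s φ ((act r).unop * e)) ∧
      ∀ φ r, s φ (act r).unop = φ r := by
  let C := ModuleCat.of R (CharacterBimodule R)
  let ev : AddCharacter C :=
    AddMonoidHom.mk' (fun φ => (show AddCharacter R from φ) 1) (fun _ _ => rfl)
  obtain ⟨ψ, hψ⟩ := AddCharacter.exists_extension (T.tmul C) h ev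
  -- The action of `r` on the character module is precomposition with `mulRight r`, so this is
  -- balancedness of the pure tensors; evaluation at `1` then returns `φ r`.
  have hact (φ : AddCharacter R) (r) :
      T.tmul C (φ.comp (mulRight r)) = T.tmul C φ ∘ₗ (act r).unop :=
    LinearMap.ext fun m => T.smul_tmul (X := C) r φ m
  refine ⟨AddMonoidHom.mk' (fun φ => AddMonoidHom.mk'
    (fun e => ψ (T.tmul C φ ∘ₗ e)) (fun e e' => ?_)) (fun φ φ' => ?_), fun φ r e => ?_,
    fun φ r => ?_⟩
  · rw [LinearMap.comp_add, map_add]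
  · ext e
    change ψ (T.tmul C (φ + φ' : C) ∘ₗ e) = ψ (T.tmul C φ ∘ₗ e) + ψ (T.tmul C φ' ∘ₗ e)
    have : T.tmul C (φ + φ' : C) = T.tmul C φ + T.tmul C φ' := map_add (T.tmul C) φ φ'
    rw [← map_add ψ, ← LinearMap.add_comp, ← this]
  · change ψ (T.tmul C (φ.comp (mulRight r)) ∘ₗ e) = ψ (T.tmul C φ ∘ₗ ((act r).unop ∘ₗ e))
    rw [hact, LinearMap.comp_assoc]
  · change ψ (T.tmul C φ ∘ₗ (act r).unop) = φ r
    rw [← hact]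
    exact (hψ _).trans (congrArg φ (one_mul r))

end TensorPresentation

/-! ### The tensor functors as instances of the general notion -/

/-- The action of `Aᵐᵒᵖ` on `M` from the side opposite to `Bᵐᵒᵖ`. -/
def leftAct (A B M : Type*) [Ring A] [Ring B] [AddCommGroup M] [Module A M] [Module Bᵐᵒᵖ M]
    [SMulCommClass A Bᵐᵒᵖ M] : Aᵐᵒᵖ →+* (Module.End Bᵐᵒᵖ M)ᵐᵒᵖ :=
  (leftMulHom A B M).op

/-- The action of `A` on `N` from the side opposite to `B`. -/
def rightAct (A B N : Type*) [Ring A] [Ring B] [AddCommGroup N] [Module B N] [Module Aᵐᵒᵖ N]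
    [SMulCommClass B Aᵐᵒᵖ N] : A →+* (Module.End B N)ᵐᵒᵖ :=
  haveI := SMulCommClass.symm B Aᵐᵒᵖ N
  (Module.toModuleEnd B N : Aᵐᵒᵖ →+* Module.End B N).op.comp (RingEquiv.opOp A).toRingHom

section Presentations

variable (A B : Type u) [Ring A] [Ring B]

/-- `- ⊗_A M` as tensoring with `M`. -/
def tensorRightPresentation (M : Type u) [AddCommGroup M] [Module A M] [Module Bᵐᵒᵖ M]
    [SMulCommClass A Bᵐᵒᵖ M] :
    TensorPresentation (tensorRightFunctor A B M) M (leftAct A B M) where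
  tmul X :=
    letI := BalancedTensor.rightModule A B X M
    AddMonoidHom.mk' (fun x => tensorUnit A B M X x)
      (fun x y => LinearMap.ext fun m => BalancedTensor.add_tmul A x y m)
  smul_tmul r x m := BalancedTensor.op_smul_tmul A x r.unop m
  map_tmul _ _ _ := rfl
  hom_ext h := BalancedTensor.hom_ext A h
  char_ext h := BalancedTensor.hom_ext A h
  exists_lift b hb := ⟨BalancedTensor.lift A b fun x a m => hb (op a) x m, fun _ _ => rfl⟩
  exists_char b hb := ⟨BalancedTensor.lift A b fun x a m => hb (op a) x m, fun _ _ => rfl⟩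

/-- `N ⊗_A -` as tensoring with `N`. -/
def tensorLeftPresentation (N : Type u) [AddCommGroup N] [Module B N] [Module Aᵐᵒᵖ N]
    [SMulCommClass B Aᵐᵒᵖ N] :
    TensorPresentation (tensorLeftFunctor A B N) N (rightAct A B N) where
  tmul Y :=
    letI := BalancedTensor.leftModule A B N Y
    AddMonoidHom.mk' (fun y => tensorUnitLeft A B N Y y)
      (fun x y => LinearMap.ext fun n => BalancedTensor.tmul_add A n x y)
  smul_tmul a y n := (BalancedTensor.op_smul_tmul A n a y).symm
  map_tmul _ _ _ := rfl
  hom_ext h := BalancedTensor.hom_ext A fun n y => h y n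
  char_ext h := BalancedTensor.hom_ext A fun n y => h y n
  exists_lift b hb := ⟨BalancedTensor.lift A b.flip fun n a y => (hb a y n).symm, fun _ _ => rfl⟩
  exists_char b hb := ⟨BalancedTensor.lift A b.flip fun n a y => (hb a y n).symm, fun _ _ => rfl⟩

end Presentations

/-! ### Dual bases -/

namespace RightDual

variable {A B M : Type*} [Ring A] [Ring B] [AddCommGroup M] [Module Bᵐᵒᵖ M]

/-- The linear map underlying an element of the dual. -/
def toLin : RightDual B M →+ (M →ₗ[Bᵐᵒᵖ] B) := AddMonoidHom.id _

theorem ext {f g : RightDual B M} (h : ∀ m, toLin f m = toLin g m) : f = g := LinearMap.ext h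

@[simp]
theorem toLin_smul (b : B) (f : RightDual B M) (m : M) : toLin (b • f) m = b * toLin f m := rfl

@[simp]
theorem toLin_op_smul [Module A M] [SMulCommClass A Bᵐᵒᵖ M] (a : A) (f : RightDual B M) (m : M) :
    toLin (op a • f) m = toLin f (a • m) := rfl

theorem exists_dualBasis (hfin : Module.Finite Bᵐᵒᵖ M) (hproj : Module.Projective Bᵐᵒᵖ M) :
    ∃ (n : ℕ) (x : Fin n → M) (f : Fin n → RightDual B M),
      ∀ m, ∑ j, op (toLin (f j) m) • x j = m := by
  obtain ⟨n, p, q, -, -, h⟩ := Module.Finite.exists_comp_eq_id_of_projective Bᵐᵒᵖ M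
  refine ⟨n, fun j => p (Pi.single j 1), fun j =>
    ({ toFun := fun m => (q m j).unop
       map_add' := fun _ _ => by simp
       map_smul' := fun b m => by simp } : M →ₗ[Bᵐᵒᵖ] B), fun m => ?_⟩
  conv_rhs => rw [← LinearMap.id_apply (R := Bᵐᵒᵖ) m, ← h, LinearMap.comp_apply,
    pi_eq_sum_univ' (q m), map_sum]
  refine Finset.sum_congr rfl fun j _ => ?_
  rw [map_smul]
  rfl

/-- The endomorphism `m' ↦ m f(m')`. -/
def rankOne : RightDual B M →+ M →+ Module.End Bᵐᵒᵖ M :=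
  AddMonoidHom.mk' (fun f => AddMonoidHom.mk' (fun m =>
      { toFun := fun m' => op (toLin f m') • m
        map_add' := fun x y => by simp [add_smul]
        map_smul' := fun b x => by simp [mul_smul] })
      (fun m m' => by ext; simp))
    (fun f g => by ext; simp [add_smul])

@[simp]
theorem rankOne_apply (f : RightDual B M) (m m' : M) :
    rankOne f m m' = op (toLin f m') • m := rfl

/-- The transpose of an endomorphism. -/
def transpose : Module.End Bᵐᵒᵖ M →+ Module.End B (RightDual B M) :=
  AddMonoidHom.mk' (fun e =>
      { toFun := fun f => (show RightDual B M from LinearMap.comp (toLin f) e)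
        map_add' := fun _ _ => rfl
        map_smul' := fun _ _ => rfl })
    (fun e e' => LinearMap.ext fun f => RightDual.ext fun m => map_add (toLin f) (e m) (e' m))

end RightDual

open RightDual

/-! ### Splitting forms from a two-sided splitting and a dual basis. -/

section Main

variable {A B M : Type u} [Ring A] [Ring B] [AddCommGroup M] [Module A M] [Module Bᵐᵒᵖ M]
  [SMulCommClass A Bᵐᵒᵖ M] (s : AddCharacter A →+ AddCharacter (Module.End Bᵐᵒᵖ M))
  (h₁ : ∀ φ a e, s (φ.comp (mulLeft a)) e = s φ (leftMulHom A B M a * e))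
  (h₂ : ∀ φ a e, s (φ.comp (mulRight a)) e = s φ (e * leftMulHom A B M a))
  (h₃ : ∀ φ a, s φ (leftMulHom A B M a) = φ a)
  {n : ℕ} (x : Fin n → M) (f : Fin n → RightDual B M)
  (hx : ∀ m, ∑ j, op (toLin (f j) m) • x j = m)

theorem leftMulHom_apply (a : A) (m : M) : leftMulHom A B M a m = a • m := rfl

theorem leftAct_apply (a : Aᵐᵒᵖ) (m : M) : (leftAct A B M a).unop m = a.unop • m := rfl

theorem rightAct_apply (a : A) (g : RightDual B M) :
    (rightAct A B (RightDual B M) a).unop g = op a • g := rfl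

include hx in
theorem sum_rankOne : ∑ j, rankOne (f j) (x j) = 1 := by
  ext m
  simp [hx]

/-- The splitting forms on `M` of an equivariant extension of characters. -/
def rightSplittingForms : SplittingForms (leftAct A B M) where
  n := n
  basis := x
  form j := AddMonoidHom.mk'
    (fun φ => (s (φ.comp (opAddEquiv : A ≃+ Aᵐᵒᵖ).toAddMonoidHom)).comp (rankOne (f j)))
    (fun φ ψ => by ext m; simp [AddMonoidHom.add_comp])
  form_act j φ r m := by
    change s (φ.comp (opAddEquiv : A ≃+ Aᵐᵒᵖ).toAddMonoidHom)
        (rankOne (f j) ((leftAct A B M r).unop m)) =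
      s ((φ.comp (opAddEquiv : A ≃+ Aᵐᵒᵖ).toAddMonoidHom).comp (mulLeft r.unop))
        (rankOne (f j) m)
    rw [h₁]
    congr 1
    ext m'
    simp [leftAct_apply, leftMulHom_apply]
  sum_form φ := by
    change ∑ j, s (φ.comp (opAddEquiv : A ≃+ Aᵐᵒᵖ).toAddMonoidHom) (rankOne (f j) (x j)) = _
    rw [← map_sum, sum_rankOne x f hx, ← map_one (leftMulHom A B M), h₃]
    rfl
  exchange r := by
    -- The coordinates of `r x_i`. Summing over `i` collapses by the dual basis identity: `∑ m f_j(r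
    -- x_i) f_i(m') = m f_j(r m')`, a rank-one map precomposed with `r`.
    refine ⟨fun i j => op (toLin (f j) (r.unop • x i)), fun i => (hx _).symm, fun φ m j => ?_⟩
    change ∑ i, s (φ.comp (opAddEquiv : A ≃+ Aᵐᵒᵖ).toAddMonoidHom)
        (rankOne (f i) (op (toLin (f j) (r.unop • x i)) • m)) =
      s ((φ.comp (opAddEquiv : A ≃+ Aᵐᵒᵖ).toAddMonoidHom).comp (mulRight r.unop))
        (rankOne (f j) m)
    rw [h₂, ← map_sum]
    congr 1
    ext m'
    conv_rhs => rw [Module.End.mul_apply, leftMulHom_apply, ← hx m']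
    simp [Finset.smul_sum, smul_smul, smul_comm r.unop]

/-- The splitting forms on the dual of `M` of an equivariant extension of characters. -/
def leftSplittingForms : SplittingForms (rightAct A B (RightDual B M)) where
  n := n
  basis := f
  form j := AddMonoidHom.mk' (fun φ => (s φ).comp (rankOne.flip (x j)))
    (fun φ ψ => by ext m; simp)
  form_act j φ a g := by
    change s φ (rankOne ((rightAct A B (RightDual B M) a).unop g) (x j)) =
      s (φ.comp (mulRight a)) (rankOne g (x j))
    rw [h₂]
    rfl
  sum_form φ := by
    change ∑ j, s φ (rankOne (f j) (x j)) = _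
    rw [← map_sum, sum_rankOne x f hx, ← map_one (leftMulHom A B M), h₃]
  exchange a := by
    -- The coordinates of `f_i ∘ a` in the `f_j`. Here the sum over `i` collapses on the other side:
    -- `∑ x_i f_i(a x_j) g(m) = a x_j g(m)`.
    refine ⟨fun i j => toLin (f i) (a • x j), fun i => RightDual.ext fun m => ?_,
      fun φ g j => ?_⟩
    · rw [rightAct_apply, toLin_op_smul]
      conv_lhs => rw [← hx m]
      simp [Finset.smul_sum, smul_comm a, map_sum]
    · change ∑ i, s φ (rankOne (toLin (f i) (a • x j) • g) (x i)) =
        s (φ.comp (mulLeft a)) (rankOne g (x j))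
      rw [h₁, ← map_sum]
      congr 1
      ext m
      conv_rhs => rw [Module.End.mul_apply, rankOne_apply, leftMulHom_apply, smul_comm,
        ← hx (a • x j)]
      simp [Finset.smul_sum, mul_smul]

end Main

theorem theorem4p1 {K : Type v} {A B M : Type u} [CommRing K] [Ring A] [Ring B]
    [Algebra K A] [Algebra K B] [AddCommGroup M] [Module A M] [Module Bᵐᵒᵖ M]
    [SMulCommClass A Bᵐᵒᵖ M]
    (hK : ∀ (k : K) (m : M), algebraMap K A k • m = op (algebraMap K B k) • m)
    (hfin : Module.Finite Bᵐᵒᵖ M) (hproj : Module.Projective Bᵐᵒᵖ M)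
    (hsep : IsSeparableAlgebra K A) :
    List.TFAE
      [TotallyFaithfulLeft A B M,
        TotallyFaithfulRight A B (RightDual B M),
        (CharacterBimodule.map (AlongHom.hom (leftMulHom A B M))).IsSplitEpi,
        IsComonadic (tensorRightFunctor A B M),
        IsComonadic (tensorLeftFunctor A B (RightDual B M))] := by
  -- By `K`-symmetry scalars act on `M` through `B`, so they commute with `B`-linear endomorphisms.
  have hcomm (k : K) (e : Module.End Bᵐᵒᵖ M) :
      leftMulHom A B M (algebraMap K A k) * e = e * leftMulHom A B M (algebraMap K A k) := by
    ext m
    rw [Module.End.mul_apply, Module.End.mul_apply, leftMulHom_apply, leftMulHom_apply, hK, hK,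
      map_smul]
  tfae_have 1 → 3 := fun h => by
    obtain ⟨s, hs, hs'⟩ := (tensorRightPresentation A B M).exists_extension (h _)
    -- The general result is over `Aᵐᵒᵖ`, where right multiplication is left multiplication in `A`;
    -- hence the version of averaging for right linear splittings.
    let opHom : AddCharacter A →+ AddCharacter Aᵐᵒᵖ := AddMonoidHom.mk'
      (fun φ => φ.comp (opAddEquiv : A ≃+ Aᵐᵒᵖ).symm.toAddMonoidHom) (fun _ _ => rfl)
    exact (isSplitEpi_map_hom_iff _).2 (exists_splitting_of_right _ hcomm hsep (s.comp opHom)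
      (fun φ a e => hs (opHom φ) (op a) e) (fun φ a => hs' (opHom φ) (op a)))
  tfae_have 2 → 3 := fun h => by
    obtain ⟨s, hs, hs'⟩ := (tensorLeftPresentation A B (RightDual B M)).exists_extension (h _)
    -- Transposition reverses products, so left multiplication on endomorphisms of the dual becomes
    -- right multiplication on endomorphisms of `M`.
    let trans : AddCharacter (Module.End B (RightDual B M)) →+
        AddCharacter (Module.End Bᵐᵒᵖ M) := AddMonoidHom.mk'
      (fun χ => χ.comp transpose) (fun _ _ => rfl)
    exact (isSplitEpi_map_hom_iff _).2 (exists_splitting_of_left _ hcomm hsep (trans.comp s)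
      (fun φ a e => hs φ a (transpose e)) (fun φ a => hs' φ a))
  tfae_have 3 → 4 := fun h => by
    obtain ⟨s, h₁, h₂, h₃⟩ := (isSplitEpi_map_hom_iff _).1 h
    obtain ⟨n, x, f, hx⟩ := exists_dualBasis hfin hproj
    exact (tensorRightPresentation A B M).isComonadic (rightSplittingForms s h₁ h₂ h₃ x f hx)
  tfae_have 3 → 5 := fun h => by
    obtain ⟨s, h₁, h₂, h₃⟩ := (isSplitEpi_map_hom_iff _).1 h
    obtain ⟨n, x, f, hx⟩ := exists_dualBasis hfin hproj
    exact (tensorLeftPresentation A B (RightDual B M)).isComonadic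
      (leftSplittingForms s h₁ h₂ h₃ x f hx)
  tfae_have 4 → 1 := fun h X _ _ =>
    (tensorRightPresentation A B M).tmul_injective_of_isComonadic h (ModuleCat.of Aᵐᵒᵖ X)
  tfae_have 5 → 2 := fun h Y _ _ =>
    (tensorLeftPresentation A B (RightDual B M)).tmul_injective_of_isComonadic h
      (ModuleCat.of A Y)
  tfae_finish
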